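/- Let $\mathcal V$ be a non-distributive variety of lattices, that is, a class of lattices defined by a set of lattice identities and containing at least one non-distributive lattice. Let $F$ be any free bounded lattice in $\mathcal V$ on at least $\aleph_2$ generators; that is, $F$ is a bounded lattice belonging to $\mathcal V$, with a family $(x_i)_{i\in I}$ of elements, $|I|\ge\aleph_2$, such that for every bounded lattice $M$ belonging to $\mathcal V$ and every map $f\colon I\to M$ there is exactly one lattice homomorphism $\varphi\colon F\to M$ preserving $0$ and $1$ with $\varphi(x_i)=f(i)$ for all $i\in I$. Then there exists no lattice $L$ with almost permutable congruences such that $\operatorname{Con_c}L\cong\operatorname{Con_c}F$. Here, for a lattice $L$, $\operatorname{Con_c}L$ denotes the $\{\vee,0\}$-semilattice of compact congruences of $L$ (the compact elements of the congruence lattice of $L$), and $L$ has almost permutable congruences if $\alpha\vee\beta=\alpha\beta\cup\beta\alpha$ for all congruences $\alpha,\beta$ of $L$, where $\alpha\beta=\{(x,y)\in L\times L : (x,z)\in\alpha \text{ and } (z,y)\in\beta \text{ for some } z\in L\}$ and $\alpha\vee\beta$ is the join in the congruence lattice of $L$. -/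

import Mathlib

open scoped Cardinal

universe u v w t

/-! ### The congruence lattice of a lattice -/

namespace LatticeCon

variable {L : Type u} [Lattice L]

theorem toSetoid_inj :
    Function.Injective (LatticeCon.toSetoid : LatticeCon L → Setoid L) := by
  rintro ⟨s, _, _⟩ ⟨s', _, _⟩ h
  cases h
  rfl

/-- Congruences are ordered by inclusion. -/
instance instPartialOrder : PartialOrder (LatticeCon L) :=
  PartialOrder.lift LatticeCon.toSetoid toSetoid_inj

theorem le_iff {α β : LatticeCon L} : α ≤ β ↔ ∀ x y, α.r x y → β.r x y :=
  ⟨fun h _ _ hxy => h hxy, fun h _ _ hxy => h _ _ hxy⟩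

/-- The intersection of a set of congruences. -/
instance instInfSet : InfSet (LatticeCon L) where
  sInf S :=
    { r := fun x y => ∀ α ∈ S, α.r x y
      iseqv :=
        { refl := fun x α _ => α.iseqv.refl x
          symm := fun h α hα => α.iseqv.symm (h α hα)
          trans := fun h h' α hα => α.iseqv.trans (h α hα) (h' α hα) }
      inf := fun h h' α hα => α.inf (h α hα) (h' α hα)
      sup := fun h h' α hα => α.sup (h α hα) (h' α hα) }

theorem sInf_isGLB (S : Set (LatticeCon L)) : IsGLB S (sInf S) :=
  ⟨fun _ hα => le_iff.2 fun _ _ h => h _ hα,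
    fun _ hβ => le_iff.2 fun x y h _ hα => le_iff.1 (hβ hα) x y h⟩

/-- `Con L`. The join `α ⊔ β` is the least congruence containing `α` and `β`. -/
instance instCompleteLattice : CompleteLattice (LatticeCon L) :=
  completeLatticeOfInf (LatticeCon L) sInf_isGLB

end LatticeCon

/-- `Con_c L`, the `{∨, 0}`-semilattice of compact congruences of `L`. -/
abbrev ConC (L : Type u) [Lattice L] : Type u :=
  {θ : LatticeCon L // IsCompactElement θ}

theorem isCompactElement_latticeCon_sup {L : Type u} [Lattice L] {α β : LatticeCon L}
    (hα : IsCompactElement α) (hβ : IsCompactElement β) : IsCompactElement (α ⊔ β) := by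
  intro s d hne hdir hlub hle
  obtain ⟨a, ha, hαa⟩ := hα s d hne hdir hlub (le_sup_left.trans hle)
  obtain ⟨b, hb, hβb⟩ := hβ s d hne hdir hlub (le_sup_right.trans hle)
  obtain ⟨c, hc, hac, hbc⟩ := hdir a ha b hb
  exact ⟨c, hc, sup_le (hαa.trans hac) (hβb.trans hbc)⟩

/-- The join in `Con_c L` is the join in `Con L`. -/
instance instSemilatticeSupConC (L : Type u) [Lattice L] : SemilatticeSup (ConC L) :=
  Subtype.semilatticeSup fun _ _ hα hβ => isCompactElement_latticeCon_sup hα hβ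

/-- The zero of `Con_c L` is the identity congruence. -/
instance instOrderBotConC (L : Type u) [Lattice L] : OrderBot (ConC L) where
  bot := ⟨⊥, fun _ _ hne _ _ _ => hne.imp fun _ ha => ⟨ha, bot_le⟩⟩
  bot_le _ := Subtype.coe_le_coe.1 bot_le

/-! ### Almost permutable congruences -/

/-- `α ∨ β = αβ ∪ βα`, where `αβ` is the relational product. -/
def AlmostPermutable {L : Type u} [Lattice L] (α β : LatticeCon L) : Prop :=
  ∀ x y : L, (α ⊔ β).r x y ↔ Relation.Comp α.r β.r x y ∨ Relation.Comp β.r α.r x y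

/-- Any two congruences of `L` are almost permutable. -/
def HasAlmostPermutableCongruences (L : Type u) [Lattice L] : Prop :=
  ∀ α β : LatticeCon L, AlmostPermutable α β

/-! ### Varieties of lattices -/

/-- Terms in the language `(∧, ∨)` of lattices with variables `x₀, x₁, x₂, …`. -/
inductive LatticeTerm : Type
  | var : ℕ → LatticeTerm
  | inf : LatticeTerm → LatticeTerm → LatticeTerm
  | sup : LatticeTerm → LatticeTerm → LatticeTerm

/-- The value of a term in a lattice under an assignment of the variables. -/
def LatticeTerm.eval {K : Type u} [Lattice K] (a : ℕ → K) : LatticeTerm → K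
  | .var n => a n
  | .inf p q => p.eval a ⊓ q.eval a
  | .sup p q => p.eval a ⊔ q.eval a

/-- A variety of lattices, presented by a set of lattice identities `p = q`. -/
structure LatticeVariety : Type where
  identities : Set (LatticeTerm × LatticeTerm)

/-- `K` belongs to the variety: it satisfies all its identities. -/
def LatticeVariety.Mem (V : LatticeVariety) (K : Type u) [Lattice K] : Prop :=
  ∀ e ∈ V.identities, ∀ a : ℕ → K, e.1.eval a = e.2.eval a

/-- Some lattice of the variety is not distributive. (The choice of the universe is immaterial,
since a failure of distributivity occurs in a sublattice with three generators.) -/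
def LatticeVariety.NonDistributive (V : LatticeVariety) : Prop :=
  ∃ (K : Type t) (_ : Lattice K), V.Mem K ∧
    ∃ x y z : K, x ⊓ (y ⊔ z) ≠ (x ⊓ y) ⊔ (x ⊓ z)

/-- `F` is a free bounded lattice in `V` on the generators `x i`, for `i : ι`: it is a bounded
lattice in `V`, and every map from the generators to a bounded lattice `M` in `V` extends uniquely
to a lattice homomorphism preserving `0` and `1`. -/
structure IsFreeBoundedLattice (V : LatticeVariety) {ι : Type v} {F : Type u}
    [Lattice F] [BoundedOrder F] (x : ι → F) : Prop where
  mem : V.Mem F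
  existsUnique_lift : ∀ (M : Type (max u v)) [Lattice M] [BoundedOrder M], V.Mem M →
    ∀ f : ι → M, ∃! φ : BoundedLatticeHom F M, ∀ i, φ (x i) = f i

/-! Almost permutability forces a refinement property of `Con_c L`, phrased in joins and order only,
which `Con_c F` violates. Let `a i ⊔ b i = e` for ℵ₂ many `i`. Each of the finitely many pairs
generating `e` lies in `a i ∘ b i` or `b i ∘ a i`. By pigeonhole these choices agree on ℵ₂ many
indices, and comparing the intermediate points gives compact `c i j`, below `a i` and `b j`, with `e
≤ c i j ⊔ a j ⊔ b i` and `c i k ≤ c i j ⊔ c j k` (`exists_refinement_of_finite_generators`). In `F`,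
let `s l ≤ t l` be the meet and join of the `l`-th pair of generators, let `a l` collapse `[⊥, s l]`
and `[t l, ⊤]`, and let `b l` collapse `[s l, t l]`. The variety contains a bounded lattice with `p
⊓ q = ⊥`, `q ⊔ r = ⊤`, `p ≰ r`. A compact `c i j` involves finitely many indices, so Kuratowski's
theorem gives `i, j, k` such that no `c` on two of them involves the third. Send `(s, t)` at `i, j,
k` to `(p, ⊤), (⊥, q), (r, ⊤)`. Then `p ⊓ q = ⊥` puts `c i j` in the kernel and `q ⊔ r = ⊤` puts `c
j k` there, hence also `c i k`. The latter persists when the values at `j` are reset to `⊥`, but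
then `p ≰ r` contradicts `e ≤ c i k ⊔ a k ⊔ b i`. -/

/-! ### Generated congruences and compactness. -/

namespace LatticeCon

variable {L : Type u} [Lattice L]

/-- The congruence generated by a set of pairs. -/
def gen (T : Set (L × L)) : LatticeCon L :=
  sInf {θ | ∀ p ∈ T, θ.r p.1 p.2}

theorem gen_le_iff {T : Set (L × L)} {θ : LatticeCon L} :
    gen T ≤ θ ↔ ∀ p ∈ T, θ.r p.1 p.2 :=
  ⟨fun h p hp => le_iff.1 h _ _ fun _ hα => hα p hp, fun h => sInf_le h⟩

theorem gen_rel {T : Set (L × L)} {x y : L} (h : (x, y) ∈ T) : (gen T).r x y :=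
  gen_le_iff.1 le_rfl (x, y) h

theorem gen_singleton_le_iff {s t : L} {θ : LatticeCon L} : gen {(s, t)} ≤ θ ↔ θ.r s t := by
  simp [gen_le_iff]

/-- The union of a nonempty directed set of congruences. -/
def directedUnion (S : Set (LatticeCon L)) (hne : S.Nonempty) (hS : DirectedOn (· ≤ ·) S) :
    LatticeCon L where
  r x y := ∃ α ∈ S, α.r x y
  iseqv :=
    { refl := fun x => hne.imp fun α hα => ⟨hα, α.iseqv.refl x⟩
      symm := fun ⟨α, hα, h⟩ => ⟨α, hα, α.iseqv.symm h⟩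
      trans := fun ⟨α, hα, h⟩ ⟨β, hβ, h'⟩ =>
        let ⟨γ, hγ, h₁, h₂⟩ := hS α hα β hβ
        ⟨γ, hγ, γ.iseqv.trans (le_iff.1 h₁ _ _ h) (le_iff.1 h₂ _ _ h')⟩ }
  inf := fun ⟨α, hα, h⟩ ⟨β, hβ, h'⟩ =>
    let ⟨γ, hγ, h₁, h₂⟩ := hS α hα β hβ
    ⟨γ, hγ, γ.inf (le_iff.1 h₁ _ _ h) (le_iff.1 h₂ _ _ h')⟩
  sup := fun ⟨α, hα, h⟩ ⟨β, hβ, h'⟩ =>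
    let ⟨γ, hγ, h₁, h₂⟩ := hS α hα β hβ
    ⟨γ, hγ, γ.sup (le_iff.1 h₁ _ _ h) (le_iff.1 h₂ _ _ h')⟩

theorem isCompactElement_gen {T : Set (L × L)} (hT : T.Finite) : IsCompactElement (gen T) := by
  intro S d hne hS hd hle
  have hU : gen T ≤ directedUnion S hne hS :=
    hle.trans (hd.2 fun α hα => le_iff.2 fun x y h => ⟨α, hα, h⟩)
  rw [gen_le_iff] at hU
  suffices ∃ α ∈ S, ∀ p ∈ T, α.r p.1 p.2 from
    this.imp fun α h => ⟨h.1, gen_le_iff.2 h.2⟩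
  clear hle
  induction T, hT using Set.Finite.induction_on with
  | empty => exact hne.imp fun α hα => ⟨hα, by simp⟩
  | @insert p T _ _ ih =>
    obtain ⟨α, hα, h⟩ := ih fun q hq => hU q (Set.mem_insert_of_mem _ hq)
    obtain ⟨β, hβ, h'⟩ := hU p (Set.mem_insert _ _)
    obtain ⟨γ, hγ, h₁, h₂⟩ := hS α hα β hβ
    refine ⟨γ, hγ, ?_⟩
    rintro q (rfl | hq)
    · exact le_iff.1 h₂ _ _ h'
    · exact le_iff.1 h₁ _ _ (h q hq)

theorem exists_finite_of_isCompactElement {θ : LatticeCon L} (hθ : IsCompactElement θ) :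
    ∃ T : Set (L × L), T.Finite ∧ ∀ α : LatticeCon L, θ ≤ α ↔ ∀ p ∈ T, α.r p.1 p.2 := by
  obtain ⟨s, hs⟩ := CompleteLattice.IsCompactElement.exists_finset_of_le_iSup _ hθ
    (fun p : {p : L × L // θ.r p.1 p.2} => gen {p.1})
    (le_iff.2 fun x y h => le_iff.1 (le_iSup (fun p : {p : L × L // θ.r p.1 p.2} => gen {p.1})
      ⟨(x, y), h⟩) _ _ (gen_rel rfl))
  refine ⟨Subtype.val '' (s : Set {p : L × L // θ.r p.1 p.2}), s.finite_toSet.image _,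
    fun α => ⟨?_, fun h => hs.trans (iSup₂_le fun p hp => gen_le_iff.2 ?_)⟩⟩
  · rintro h _ ⟨p, -, rfl⟩
    exact le_iff.1 h _ _ p.2
  · rintro _ rfl
    exact h _ ⟨p, hp, rfl⟩

/-- A congruence identifies two elements iff it identifies their meet and join. Ordered pairs allow
intermediate points to be taken inside intervals. -/
theorem exists_finite_ordered_of_isCompactElement {θ : LatticeCon L} (hθ : IsCompactElement θ) :
    ∃ T : Set (L × L), T.Finite ∧ (∀ p ∈ T, p.1 ≤ p.2) ∧
      ∀ α : LatticeCon L, θ ≤ α ↔ ∀ p ∈ T, α.r p.1 p.2 := by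
  obtain ⟨T, hT, h⟩ := exists_finite_of_isCompactElement hθ
  refine ⟨(fun p => (p.1 ⊓ p.2, p.1 ⊔ p.2)) '' T, hT.image _, ?_, fun α => ?_⟩
  · rintro _ ⟨p, -, rfl⟩
    exact inf_le_sup
  · rw [h, Set.forall_mem_image]
    simp only [r_inf_sup_iff]

/-- Relational products of congruences restrict to intervals. -/
theorem exists_between_of_comp {α β : LatticeCon L} {x y : L} (hxy : x ≤ y)
    (h : Relation.Comp α.r β.r x y) : ∃ z, x ≤ z ∧ z ≤ y ∧ α.r x z ∧ β.r z y := by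
  obtain ⟨z, h₁, h₂⟩ := h
  refine ⟨(z ⊔ x) ⊓ y, le_inf le_sup_right hxy, inf_le_right, ?_, ?_⟩
  · have := α.inf (α.sup h₁ (α.iseqv.refl x)) (α.iseqv.refl y)
    rwa [sup_idem, inf_eq_left.2 hxy] at this
  · have := β.inf (β.sup h₂ (β.iseqv.refl x)) (β.iseqv.refl y)
    rwa [sup_eq_left.2 hxy, inf_idem] at this

end LatticeCon

/-! ### A uniform refinement property -/

section Refinement

open LatticeCon

variable {L : Type u} [Lattice L]

/-- The relation `x ≤ y` modulo `θ`, expressed as `θ.r (x ⊓ y) x`, is transitive. -/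
theorem LatticeCon.rel_inf_trans {θ : LatticeCon L} {x y z : L} (h₁ : θ.r (x ⊓ y) x)
    (h₂ : θ.r (y ⊓ z) y) : θ.r (x ⊓ z) x := by
  have h₃ := θ.inf (θ.iseqv.refl x) h₂
  rw [← inf_assoc] at h₃
  have h₄ := θ.inf h₁ (θ.iseqv.refl z)
  exact θ.iseqv.trans (θ.iseqv.symm h₄) (θ.iseqv.trans h₃ h₁)

/-- For `p ∈ O` let `z i` lie between `p.1` and `p.2` with `p.1 ~ z i` mod `a i` and `z i ~ p.2` mod
`b i`; let `c i j` force `z i ≤ z j`. This holds mod `a i` since `z i ~ p.1 ≤ z j`, and mod `b j`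
since `z i ≤ p.2 ~ z j`. Modulo `c i j ⊔ a j ⊔ b i`, `p.2 ~ z i ≤ z j ~ p.1`. The last inequality is
transitivity of `≤`. -/
theorem exists_refinement_of_finite_generators {I : Type v} (a b : I → LatticeCon L)
    {T : Set (L × L)} (hT : T.Finite) (hle : ∀ p ∈ T, p.1 ≤ p.2) (O : Set (L × L))
    (h₁ : ∀ p ∈ T, p ∈ O → ∀ i, Relation.Comp (a i).r (b i).r p.1 p.2)
    (h₂ : ∀ p ∈ T, p ∉ O → ∀ i, Relation.Comp (b i).r (a i).r p.1 p.2) :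
    ∃ c : I → I → LatticeCon L, ∀ i j k, IsCompactElement (c i j) ∧ c i j ≤ a i ∧ c i j ≤ b j ∧
      gen T ≤ c i j ⊔ a j ⊔ b i ∧ c i k ≤ c i j ⊔ c j k := by
  classical
  have key : ∀ p : T, ∀ i, ∃ z, p.1.1 ≤ z ∧ z ≤ p.1.2 ∧
      (p.1 ∈ O → (a i).r p.1.1 z ∧ (b i).r z p.1.2) ∧
      (p.1 ∉ O → (b i).r p.1.1 z ∧ (a i).r z p.1.2) := by
    rintro ⟨p, hp⟩ i
    by_cases hO : p ∈ O
    · obtain ⟨z, hz⟩ := exists_between_of_comp (hle p hp) (h₁ p hp hO i)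
      exact ⟨z, hz.1, hz.2.1, fun _ => hz.2.2, fun h => absurd hO h⟩
    · obtain ⟨z, hz⟩ := exists_between_of_comp (hle p hp) (h₂ p hp hO i)
      exact ⟨z, hz.1, hz.2.1, fun h => absurd h hO, fun _ => hz.2.2⟩
  choose z hz₁ hz₂ hz₃ hz₄ using key
  have : Finite T := hT
  -- Outside `O` the roles of `a` and `b` are exchanged, so the forced inequality is reversed to `z
  -- j ≤ z i`.
  let g : I → I → T → L × L := fun i j p =>
    if p.1 ∈ O then (z p i ⊓ z p j, z p i) else (z p j ⊓ z p i, z p j)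
  have gpos : ∀ {i j} {p : T}, p.1 ∈ O → g i j p = (z p i ⊓ z p j, z p i) := fun h => if_pos h
  have gneg : ∀ {i j} {p : T}, p.1 ∉ O → g i j p = (z p j ⊓ z p i, z p j) := fun h => if_neg h
  have grel : ∀ i j p, (gen (Set.range (g i j))).r (g i j p).1 (g i j p).2 :=
    fun i j p => gen_rel ⟨p, rfl⟩
  have lower : ∀ (α : LatticeCon L) (p : T) (i j), α.r p.1.1 (z p i) →
      α.r (z p i ⊓ z p j) (z p i) := fun α p i j h => by
    have := α.inf h (α.iseqv.refl (z p j))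
    rw [inf_eq_left.2 (hz₁ p j)] at this
    exact α.iseqv.trans (α.iseqv.symm this) h
  have upper : ∀ (α : LatticeCon L) (p : T) (i j), α.r (z p j) p.1.2 →
      α.r (z p i ⊓ z p j) (z p i) := fun α p i j h => by
    have := α.inf (α.iseqv.refl (z p i)) h
    rwa [inf_eq_left.2 (hz₂ p i)] at this
  have join : ∀ (α : LatticeCon L) (p : T) (i j), α.r (z p i ⊓ z p j) (z p i) →
      α.r p.1.1 (z p j) → α.r (z p i) p.1.2 → α.r p.1.1 p.1.2 := fun α p i j h h' h'' => by
    have := α.inf (α.iseqv.refl (z p i)) h'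
    rw [inf_eq_right.2 (hz₁ p i)] at this
    exact α.iseqv.trans this (α.iseqv.trans h h'')
  refine ⟨fun i j => gen (Set.range (g i j)), fun i j k =>
    ⟨isCompactElement_gen (Set.finite_range _), gen_le_iff.2 ?_, gen_le_iff.2 ?_,
      gen_le_iff.2 ?_, gen_le_iff.2 ?_⟩⟩
  · rintro _ ⟨p, rfl⟩
    by_cases hO : p.1 ∈ O
    · rw [gpos hO]; exact lower _ _ _ _ (hz₃ p i hO).1
    · rw [gneg hO]; exact upper _ _ _ _ (hz₄ p i hO).2
  · rintro _ ⟨p, rfl⟩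
    by_cases hO : p.1 ∈ O
    · rw [gpos hO]; exact upper _ _ _ _ (hz₃ p j hO).2
    · rw [gneg hO]; exact lower _ _ _ _ (hz₄ p j hO).1
  · intro p hp
    have hc := le_iff.1 ((le_sup_left (b := a j)).trans (le_sup_left (b := b i))) _ _
      (grel i j ⟨p, hp⟩)
    have ha := fun x y => le_iff.1 ((le_sup_right (a := gen (Set.range (g i j)))
      (b := a j)).trans (le_sup_left (b := b i))) x y
    have hb := fun x y => le_iff.1 (le_sup_right (a := gen (Set.range (g i j)) ⊔ a j)
      (b := b i)) x y
    by_cases hO : p ∈ O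
    · rw [gpos hO] at hc
      exact join _ ⟨p, hp⟩ i j hc (ha _ _ (hz₃ _ j hO).1) (hb _ _ (hz₃ _ i hO).2)
    · rw [gneg hO] at hc
      exact join _ ⟨p, hp⟩ j i hc (hb _ _ (hz₄ _ i hO).1) (ha _ _ (hz₄ _ j hO).2)
  · rintro _ ⟨p, rfl⟩
    have h₁ := le_iff.1 (le_sup_left (b := gen (Set.range (g j k)))) _ _
      (grel i j p)
    have h₂ := le_iff.1 (le_sup_right (a := gen (Set.range (g i j)))) _ _
      (grel j k p)
    by_cases hO : p.1 ∈ O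
    · rw [gpos hO] at h₁ h₂ ⊢
      exact rel_inf_trans h₁ h₂
    · rw [gneg hO] at h₁ h₂ ⊢
      exact rel_inf_trans h₂ h₁

/-- If the congruences of `L` are almost permutable, then every family of decompositions of a
compact congruence has a refinement on a subfamily of the same regular cardinality. -/
theorem HasAlmostPermutableCongruences.exists_refinement
    (hL : HasAlmostPermutableCongruences L) {I : Type v} {κ : Cardinal.{v}} (hκ : κ.IsRegular)
    (hI : κ ≤ #I) (e : ConC L) (a b : I → ConC L) (hab : ∀ i, a i ⊔ b i = e) :
    ∃ J : Set I, κ ≤ #J ∧ ∃ c : J → J → ConC L, ∀ i j k,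
      c i j ≤ a i ∧ c i j ≤ b j ∧ e ≤ c i j ⊔ a j ⊔ b i ∧ c i k ≤ c i j ⊔ c j k := by
  obtain ⟨T, hT, hle, hTe⟩ := exists_finite_ordered_of_isCompactElement e.2
  have : Finite T := hT
  obtain ⟨n, ⟨f⟩⟩ := Finite.exists_equiv_fin (Set T)
  -- `pat i` records which generating pairs factor in the order `a i`, `b i`. There are finitely
  -- many patterns, so one occurs at least `κ` times.
  let pat : I → Set T := fun i => {p | Relation.Comp (a i).1.r (b i).1.r p.1.1 p.1.2}
  obtain ⟨O, hO⟩ := Cardinal.infinite_pigeonhole_card (fun i => ULift.up.{v} (f (pat i))) κ hI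
    hκ.aleph0_le (by
      rw [hκ.cof_ord]
      exact (Cardinal.lt_aleph0_of_finite _).trans_le hκ.aleph0_le)
  have hpat : ∀ i : ((fun i => ULift.up.{v} (f (pat i))) ⁻¹' {O} : Set I),
      pat i = f.symm O.down := fun i => by
    rw [Equiv.eq_symm_apply]; exact congrArg ULift.down i.2
  have hsup : ∀ i, ∀ p ∈ T, Relation.Comp (a i).1.r (b i).1.r p.1 p.2 ∨
      Relation.Comp (b i).1.r (a i).1.r p.1 p.2 := fun i p hp => by
    refine (hL (a i).1 (b i).1 p.1 p.2).1 ?_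
    have : (a i).1 ⊔ (b i).1 = e.1 := congrArg Subtype.val (hab i)
    rw [this]
    exact (hTe e.1).1 le_rfl p hp
  obtain ⟨c, hc⟩ := exists_refinement_of_finite_generators
    (I := ((fun i => ULift.up.{v} (f (pat i))) ⁻¹' {O} : Set I))
    (fun i => (a i).1) (fun i => (b i).1) hT hle (Subtype.val '' (f.symm O.down)) (by
      rintro p hp ⟨q, hq, rfl⟩ i
      rw [← hpat i] at hq
      exact hq) (by
      intro p hp hq i
      refine (hsup i p hp).resolve_left fun h => hq ⟨⟨p, hp⟩, ?_, rfl⟩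
      rw [← hpat i]
      exact h)
  refine ⟨_, hO, fun i j => ⟨c i j, (hc i j j).1⟩, fun i j k => ⟨(hc i j k).2.1,
    (hc i j k).2.2.1, ?_, (hc i j k).2.2.2.2⟩⟩
  have he : e.1 ≤ gen T := (hTe _).2 fun p hp => gen_rel hp
  exact he.trans (hc i j k).2.2.2.1

end Refinement

/-! ### Free sets -/

/-- Kuratowski's free set theorem for pairs. -/
theorem Cardinal.exists_free_triple {J : Type v} (hJ : ℵ_ 2 ≤ #J) (Ψ : J → J → Set J)
    (hΨ : ∀ i j, (Ψ i j).Finite) :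
    ∃ i j k, i ≠ j ∧ j ≠ k ∧ i ≠ k ∧ k ∉ Ψ i j ∧ i ∉ Ψ j k ∧ j ∉ Ψ i k := by
  have mk_le : ∀ (κ : Cardinal.{v}), ℵ₀ ≤ κ → ∀ (s : Set J) (Φ : J → Set J), #s ≤ κ →
      (∀ i ∈ s, #(Φ i) ≤ κ) → #(⋃ i ∈ s, Φ i : Set J) ≤ κ := fun κ hκ s Φ hs h =>
    (Cardinal.mk_biUnion_le _ _).trans
      ((mul_le_mul' hs (ciSup_le' fun i : s => h i.1 i.2)).trans (Cardinal.mul_eq_self hκ).le)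
  have exists_notMem : ∀ s t : Set J, #t < #s → ∃ i ∈ s, i ∉ t := fun s t h => by
    by_contra! H
    exact h.not_ge (Cardinal.mk_le_mk_of_subset H)
  have fin_le : ∀ i j, #(Ψ i j) ≤ ℵ₀ := fun i j =>
    Cardinal.mk_le_aleph0_iff.2 (hΨ i j).countable.to_subtype
  have h12 : ℵ_ 1 < ℵ_ 2 := Cardinal.aleph_lt_aleph.2 (by norm_num)
  -- The indices are chosen in the order `k`, `i`, `j`: `k` avoids a closure of size ℵ₁, `i ∈ A` a
  -- countable one, and `j ∈ B` a finite set.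
  obtain ⟨A, hA⟩ := Cardinal.le_mk_iff_exists_set.1 (h12.le.trans hJ)
  have h01 : ℵ₀ < #A := by rw [hA]; exact Cardinal.aleph0_lt_aleph_one
  obtain ⟨k, -, hk⟩ := exists_notMem Set.univ (A ∪ ⋃ i ∈ A, ⋃ j ∈ A, Ψ i j) (by
    rw [Cardinal.mk_univ]
    refine lt_of_le_of_lt ?_ (h12.trans_le hJ)
    refine (Cardinal.mk_union_le _ _).trans
      (Cardinal.add_le_of_le (Cardinal.aleph0_le_aleph 1) hA.le ?_)
    exact mk_le _ (Cardinal.aleph0_le_aleph 1) _ _ hA.le fun i _ =>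
      mk_le _ (Cardinal.aleph0_le_aleph 1) _ _ hA.le fun j _ =>
        (fin_le i j).trans (Cardinal.aleph0_le_aleph 1))
  obtain ⟨B, hBA, hB⟩ := Cardinal.le_mk_iff_exists_subset.1 h01.le
  obtain ⟨i, hiA, hi⟩ := exists_notMem A (B ∪ ⋃ j ∈ B, Ψ j k) (by
    refine lt_of_le_of_lt ?_ h01
    exact (Cardinal.mk_union_le _ _).trans (Cardinal.add_le_of_le le_rfl hB.le
      (mk_le _ le_rfl _ _ hB.le fun j _ => fin_le j k)))
  have hBinf : B.Infinite := Set.infinite_coe_iff.1 (Cardinal.infinite_iff.2 hB.ge)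
  obtain ⟨j, hjB, hj⟩ := hBinf.exists_notMem_finite (hΨ i k)
  simp only [Set.mem_union, Set.mem_iUnion, not_or, not_exists] at hk hi
  exact ⟨i, j, k, fun h => hi.1 (h ▸ hjB), fun h => hk.1 (h ▸ hBA hjB),
    fun h => hk.1 (h ▸ hiA), hk.2 i hiA j (hBA hjB), hi.2 j hjB, hj⟩

/-! ### Lattices in a variety -/

theorem LatticeTerm.map_eval {K : Type u} {M : Type v} [Lattice K] [Lattice M] (f : LatticeHom K M)
    (a : ℕ → K) (p : LatticeTerm) : f (p.eval a) = p.eval (f ∘ a) := by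
  induction p with
  | var n => rfl
  | inf p q hp hq => simp only [eval, map_inf, hp, hq]
  | sup p q hp hq => simp only [eval, map_sup, hp, hq]

theorem LatticeVariety.Mem.of_injective {V : LatticeVariety} {K : Type u} {M : Type v} [Lattice K]
    [Lattice M] (hM : V.Mem M) (f : LatticeHom K M) (hf : Function.Injective f) : V.Mem K :=
  fun e he a => hf (by rw [LatticeTerm.map_eval, LatticeTerm.map_eval]; exact hM e he _)

/-- This configuration treats both forbidden sublattices at once: three atoms of `M₃`, or `r < p`
with their common complement `q` in `N₅`. -/
theorem exists_not_le_of_not_distributive {K : Type u} [Lattice K] {x y z : K}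
    (h : x ⊓ (y ⊔ z) ≠ (x ⊓ y) ⊔ (x ⊓ z)) :
    ∃ p q r : K, p ⊓ q ≤ r ∧ p ≤ q ⊔ r ∧ ¬ p ≤ r := by
  by_cases hp : x ⊓ (y ⊔ z) ≤ x ⊓ y ⊔ z
  · refine ⟨x ⊓ (y ⊔ z), z, x ⊓ y ⊔ x ⊓ z, ?_, ?_, fun h' => h (h'.antisymm ?_)⟩
    · exact le_sup_of_le_right (inf_le_inf_right _ inf_le_left)
    · exact hp.trans (sup_le (le_sup_of_le_right le_sup_left) le_sup_left)
    · exact sup_le (inf_le_inf_left _ le_sup_left) (inf_le_inf_left _ le_sup_right)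
  · refine ⟨x ⊓ (y ⊔ z), y, x ⊓ y ⊔ z, ?_, ?_, hp⟩
    · exact le_sup_of_le_left (inf_le_inf_right _ inf_le_left)
    · exact inf_le_right.trans (sup_le le_sup_left (le_sup_of_le_right le_sup_right))

/-- A non-distributive variety contains, in every universe, a bounded lattice with elements
`p`, `q`, `r` such that `p ⊓ q = ⊥`, `q ⊔ r = ⊤` and `p ≰ r`. -/
theorem LatticeVariety.NonDistributive.exists_bounded {V : LatticeVariety}
    (hV : LatticeVariety.NonDistributive.{t} V) :
    ∃ (M : Type w) (_ : Lattice M) (_ : BoundedOrder M), V.Mem M ∧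
      ∃ p q r : M, p ⊓ q = ⊥ ∧ q ⊔ r = ⊤ ∧ ¬ p ≤ r := by
  obtain ⟨K, _, hK, x, y, z, hxyz⟩ := hV
  obtain ⟨p, q, r, h₁, h₂, h₃⟩ := exists_not_le_of_not_distributive hxyz
  let a : ℕ → K := fun n => if n = 0 then p else if n = 1 then q else r
  -- The sublattice generated by `p, q, r` has bounds `p ⊓ q` and `q ⊔ r`. As an image of the terms,
  -- which live in `Type`, it is small in every universe.
  let S : Sublattice K :=
    { carrier := Set.range (LatticeTerm.eval a)
      supClosed' := by rintro _ ⟨s, rfl⟩ _ ⟨s', rfl⟩; exact ⟨.sup s s', rfl⟩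
      infClosed' := by rintro _ ⟨s, rfl⟩ _ ⟨s', rfl⟩; exact ⟨.inf s s', rfl⟩ }
  have hp : p ∈ S := ⟨.var 0, rfl⟩
  have hq : q ∈ S := ⟨.var 1, rfl⟩
  have hr : r ∈ S := ⟨.var 2, rfl⟩
  have ha : ∀ n, p ⊓ q ≤ a n ∧ a n ≤ q ⊔ r := fun n => by
    by_cases h0 : n = 0
    · simp only [a, h0, if_true]; exact ⟨inf_le_left, h₂⟩
    by_cases h1 : n = 1
    · simp only [a, h1, one_ne_zero, if_true, if_false]; exact ⟨inf_le_right, le_sup_left⟩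
    · simp only [a, h0, h1, if_false]; exact ⟨h₁, le_sup_right⟩
  have hbd : ∀ s : LatticeTerm, p ⊓ q ≤ s.eval a ∧ s.eval a ≤ q ⊔ r := fun s => by
    induction s with
    | var n => exact ha n
    | inf s s' h h' => exact ⟨le_inf h.1 h'.1, inf_le_of_left_le h.2⟩
    | sup s s' h h' => exact ⟨le_sup_of_le_left h.1, sup_le h.2 h'.2⟩
  have : Small.{w} S := inferInstanceAs (Small.{w} (Set.range (LatticeTerm.eval a)))
  let E : Shrink.{w} S ≃ S := (equivShrink S).symm
  let : Lattice (Shrink.{w} S) := E.lattice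
  let f : LatticeHom (Shrink.{w} S) K :=
    { toFun := fun m => (E m : K)
      map_sup' := fun m n => congrArg Subtype.val (E.apply_symm_apply (E m ⊔ E n))
      map_inf' := fun m n => congrArg Subtype.val (E.apply_symm_apply (E m ⊓ E n)) }
  have hf : Function.Injective f := Subtype.val_injective.comp E.injective
  have hfle : ∀ {m n}, f m ≤ f n → m ≤ n := fun {m n} h => by
    rw [← inf_eq_left] at h ⊢
    exact hf (by rw [map_inf, h])
  have hfE : ∀ k (hk : k ∈ S), f (E.symm ⟨k, hk⟩) = k := fun k hk =>
    congrArg Subtype.val (E.apply_symm_apply _)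
  let : BoundedOrder (Shrink.{w} S) :=
    { bot := E.symm ⟨p ⊓ q, S.infClosed hp hq⟩
      top := E.symm ⟨q ⊔ r, S.supClosed hq hr⟩
      bot_le := fun m => hfle (by
        rw [hfE]
        obtain ⟨s, hs⟩ := (E m).2
        exact (hbd s).1.trans_eq hs)
      le_top := fun m => hfle (by
        rw [hfE]
        obtain ⟨s, hs⟩ := (E m).2
        exact hs.symm.trans_le (hbd s).2) }
  refine ⟨Shrink.{w} S, inferInstance, inferInstance, hK.of_injective f hf, E.symm ⟨p, hp⟩,
    E.symm ⟨q, hq⟩, E.symm ⟨r, hr⟩, hf ?_, hf ?_, fun h => h₃ ?_⟩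
  · rw [map_inf, hfE, hfE]; exact (hfE _ _).symm
  · rw [map_sup, hfE, hfE]; exact (hfE _ _).symm
  · have := OrderHomClass.mono f h
    rwa [hfE, hfE] at this

/-! ### Free bounded lattices -/

namespace IsFreeBoundedLattice

variable {V : LatticeVariety} {ι : Type v} {F : Type u} [Lattice F] [BoundedOrder F] {x : ι → F}

/-- A free bounded lattice is generated by its free generators. -/
theorem induction (hF : IsFreeBoundedLattice V x) {P : F → Prop} (gen : ∀ i, P (x i))
    (bot : P ⊥) (top : P ⊤) (inf : ∀ g h, P g → P h → P (g ⊓ h))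
    (sup : ∀ g h, P g → P h → P (g ⊔ h)) (g : F) : P g := by
  let S : Sublattice F :=
    { carrier := {g | P g}
      supClosed' := fun _ h _ h' => sup _ _ h h'
      infClosed' := fun _ h _ h' => inf _ _ h h' }
  -- The universal property concerns lattices in `Type (max u v)`, hence the lifts.
  let : BoundedOrder (ULift.{v} S) :=
    { bot := ⟨⊥, bot⟩
      top := ⟨⊤, top⟩
      bot_le := fun m => show (⟨⊥, bot⟩ : S) ≤ m.down from (bot_le : ⊥ ≤ (m.down : F))
      le_top := fun m => show m.down ≤ (⟨⊤, top⟩ : S) from (le_top : (m.down : F) ≤ ⊤) }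
  let : BoundedOrder (ULift.{v} F) :=
    { bot := ⟨⊥⟩
      top := ⟨⊤⟩
      bot_le := fun m => show ⊥ ≤ m.down from bot_le
      le_top := fun m => show m.down ≤ ⊤ from le_top }
  let incl : BoundedLatticeHom (ULift.{v} S) (ULift.{v} F) :=
    { toFun := fun m => ⟨m.down⟩
      map_sup' := fun _ _ => rfl
      map_inf' := fun _ _ => rfl
      map_top' := rfl
      map_bot' := rfl }
  let up : BoundedLatticeHom F (ULift.{v} F) :=
    { toFun := fun m => ⟨m⟩
      map_sup' := fun _ _ => rfl
      map_inf' := fun _ _ => rfl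
      map_top' := rfl
      map_bot' := rfl }
  let down : LatticeHom (ULift.{v} F) F :=
    { toFun := fun m => m.down
      map_sup' := fun _ _ => rfl
      map_inf' := fun _ _ => rfl }
  have hVF : V.Mem (ULift.{v} F) := hF.mem.of_injective down ULift.down_injective
  have hVS : V.Mem (ULift.{v} S) := hVF.of_injective incl.toLatticeHom fun m n h =>
    ULift.down_injective (Subtype.val_injective (congrArg ULift.down h))
  obtain ⟨φ, hφ, -⟩ := hF.existsUnique_lift _ hVS fun i => ⟨⟨x i, gen i⟩⟩
  have := (hF.existsUnique_lift _ hVF fun i => ⟨x i⟩).unique (y₁ := incl.comp φ) (y₂ := up)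
    (fun i => congrArg incl (hφ i)) fun i => rfl
  have hg : ((φ g).down : F) = g := congrArg ULift.down (DFunLike.congr_fun this g)
  exact hg ▸ (φ g).down.2

/-- Homomorphisms from a free bounded lattice into `M`, given by a family of pairs of elements
of `M`. Each value depends only on finitely many members of the family. -/
theorem exists_homs (hF : IsFreeBoundedLattice V x) {J : Type w} (e : J × Bool ↪ ι)
    {M : Type (max u v)} [Lattice M] [BoundedOrder M] (hM : V.Mem M) :
    ∃ H : (J → M × M) → BoundedLatticeHom F M,
      (∀ w l, H w (x (e (l, true))) = (w l).1) ∧ (∀ w l, H w (x (e (l, false))) = (w l).2) ∧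
      (∀ g, ∃ Y : Set J, Y.Finite ∧ ∀ w w', Set.EqOn w w' Y → H w g = H w' g) ∧
      ∀ w (P : M → Prop), (∀ l, P (w l).1 ∧ P (w l).2) → P ⊥ → P ⊤ →
        (∀ g h, P g → P h → P (g ⊓ h)) → (∀ g h, P g → P h → P (g ⊔ h)) → ∀ g, P (H w g) := by
  choose Φ hΦ using fun f : ι → M => (hF.existsUnique_lift M hM f).exists
  -- Unused generators go to `⊥`, so that they add neither dependence on `w` nor new elements to the
  -- range.
  let ext : (J → M × M) → ι → M := fun w =>
    Function.extend e (fun lb => bif lb.2 then (w lb.1).1 else (w lb.1).2) fun _ => ⊥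
  have hext : ∀ w lb, ext w (e lb) = bif lb.2 then (w lb.1).1 else (w lb.1).2 := fun w lb =>
    e.injective.extend_apply _ _ _
  have hext' : ∀ w i, (¬ ∃ lb, e lb = i) → ext w i = ⊥ := fun w i hi =>
    Function.extend_apply' _ _ _ hi
  refine ⟨fun w => Φ (ext w), fun w l => ?_, fun w l => ?_, fun g => ?_, ?_⟩
  · rw [hΦ, hext]; rfl
  · rw [hΦ, hext]; rfl
  · induction g using hF.induction with
    | gen i =>
      by_cases hi : ∃ lb, e lb = i
      · obtain ⟨lb, rfl⟩ := hi
        refine ⟨{lb.1}, Set.finite_singleton _, fun w w' h => ?_⟩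
        rw [hΦ, hΦ, hext, hext, h rfl]
      · exact ⟨∅, Set.finite_empty, fun w w' h => by rw [hΦ, hΦ, hext' _ _ hi, hext' _ _ hi]⟩
    | bot => exact ⟨∅, Set.finite_empty, fun w w' h => by rw [map_bot, map_bot]⟩
    | top => exact ⟨∅, Set.finite_empty, fun w w' h => by rw [map_top, map_top]⟩
    | inf g h ihg ihh =>
      obtain ⟨Y, hY, hYw⟩ := ihg
      obtain ⟨Z, hZ, hZw⟩ := ihh
      refine ⟨Y ∪ Z, hY.union hZ, fun w w' h => ?_⟩
      rw [map_inf, map_inf, hYw w w' (h.mono Set.subset_union_left),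
        hZw w w' (h.mono Set.subset_union_right)]
    | sup g h ihg ihh =>
      obtain ⟨Y, hY, hYw⟩ := ihg
      obtain ⟨Z, hZ, hZw⟩ := ihh
      refine ⟨Y ∪ Z, hY.union hZ, fun w w' h => ?_⟩
      rw [map_sup, map_sup, hYw w w' (h.mono Set.subset_union_left),
        hZw w w' (h.mono Set.subset_union_right)]
  · intro w P hw hbot htop hinf hsup g
    induction g using hF.induction with
    | gen i =>
      rw [hΦ]
      by_cases hi : ∃ lb, e lb = i
      · obtain ⟨⟨l, b⟩, rfl⟩ := hi
        rw [hext]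
        cases b
        · exact (hw l).2
        · exact (hw l).1
      · rwa [hext' _ _ hi]
    | bot => rwa [map_bot]
    | top => rwa [map_top]
    | inf g h ihg ihh => rw [map_inf]; exact hinf _ _ ihg ihh
    | sup g h ihg ihh => rw [map_sup]; exact hsup _ _ ihg ihh

end IsFreeBoundedLattice

/-! ### Congruences of bounded lattices -/

namespace LatticeCon

variable {F : Type u} [Lattice F] [BoundedOrder F] {M : Type v} [Lattice M] [BoundedOrder M]

/-- The congruence collapsing the intervals `[⊥, s]` and `[t, ⊤]`. -/
def outer (s t : F) : LatticeCon F := gen {(⊥, s), (t, ⊤)}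

theorem outer_le_iff {s t : F} {θ : LatticeCon F} : outer s t ≤ θ ↔ θ.r ⊥ s ∧ θ.r t ⊤ := by
  simp [outer, gen_le_iff]

theorem isCompactElement_outer (s t : F) : IsCompactElement (outer s t) :=
  isCompactElement_gen (by simp)

theorem outer_sup_gen (s t : F) : outer s t ⊔ gen {(s, t)} = gen {(⊥, ⊤)} := by
  have all : ∀ g h : F, (gen {(⊥, ⊤)} : LatticeCon F).r g h := fun g h => by
    have h₀ : (gen {(⊥, ⊤)} : LatticeCon F).r ⊥ ⊤ := gen_rel rfl
    have h₁ : ∀ k : F, (gen {(⊥, ⊤)} : LatticeCon F).r ⊥ k := fun k => by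
      have := (gen {(⊥, ⊤)} : LatticeCon F).inf h₀
        ((gen {(⊥, ⊤)} : LatticeCon F).iseqv.refl k)
      rwa [bot_inf_eq, top_inf_eq] at this
    exact (gen {(⊥, ⊤)} : LatticeCon F).iseqv.trans
      ((gen {(⊥, ⊤)} : LatticeCon F).iseqv.symm (h₁ g)) (h₁ h)
  refine le_antisymm (le_iff.2 fun g h _ => all g h) (gen_singleton_le_iff.2 ?_)
  have h₁ := outer_le_iff.1 (le_sup_left (a := outer s t) (b := gen {(s, t)}))
  have h₂ := gen_singleton_le_iff.1 (le_sup_right (a := outer s t) (b := gen {(s, t)}))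
  exact (outer s t ⊔ gen {(s, t)}).iseqv.trans h₁.1
    ((outer s t ⊔ gen {(s, t)}).iseqv.trans h₂ h₁.2)

/-- The congruence of joining with `m`, for a distributive element `m` of the range of `f`. -/
def supKer (f : BoundedLatticeHom F M) (m : M)
    (hm : ∀ g h, f g ⊓ f h ⊔ m = (f g ⊔ m) ⊓ (f h ⊔ m)) : LatticeCon F where
  r g h := f g ⊔ m = f h ⊔ m
  iseqv := ⟨fun _ => rfl, Eq.symm, Eq.trans⟩
  inf := fun h h' => by rw [map_inf, map_inf, hm, hm, h, h']
  sup := fun h h' => by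
    rw [map_sup, map_sup, sup_sup_distrib_right, h, h', ← sup_sup_distrib_right]

/-- The congruence of meeting with `m`, for a dually distributive element `m` of the range of
`f`. -/
def infKer (f : BoundedLatticeHom F M) (m : M)
    (hm : ∀ g h, (f g ⊔ f h) ⊓ m = (f g ⊓ m) ⊔ (f h ⊓ m)) : LatticeCon F where
  r g h := f g ⊓ m = f h ⊓ m
  iseqv := ⟨fun _ => rfl, Eq.symm, Eq.trans⟩
  inf := fun h h' => by
    rw [map_inf, map_inf, inf_inf_distrib_right, h, h', ← inf_inf_distrib_right]
  sup := fun h h' => by rw [map_sup, map_sup, hm, hm, h, h']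

/-- In the image, the two bounds on `c` collapse only `[⊥, p]` and `[⊥, q]`. The range is so small
that joining with `p` or with `q` is a homomorphism, and `(m ⊔ p) ⊓ (m ⊔ q) = m` on it because `p ⊓
q = ⊥`. -/
theorem le_ker_of_inf_eq_bot {f : BoundedLatticeHom F M} {p q : M} (hpq : p ⊓ q = ⊥)
    (hf : ∀ g, f g = ⊥ ∨ f g = p ∨ f g = q ∨ f g = p ⊔ q ∨ f g = ⊤) {s t s' t' : F}
    (hs : f s = p) (ht : f t = ⊤) (hs' : f s' = ⊥) (ht' : f t' = q) {c : LatticeCon F}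
    (hc : c ≤ outer s t) (hc' : c ≤ gen {(s', t')}) : c ≤ ker f := by
  have hqp : q ⊓ p = ⊥ := by rw [inf_comm, hpq]
  have h₁ : ∀ g h, f g ⊓ f h ⊔ p = (f g ⊔ p) ⊓ (f h ⊔ p) := fun g h => by
    rcases hf g with h₁ | h₁ | h₁ | h₁ | h₁ <;> rcases hf h with h₂ | h₂ | h₂ | h₂ | h₂ <;>
      simp [h₁, h₂, hpq, hqp, sup_comm q p]
  have h₂ : ∀ g h, f g ⊓ f h ⊔ q = (f g ⊔ q) ⊓ (f h ⊔ q) := fun g h => by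
    rcases hf g with h₁ | h₁ | h₁ | h₁ | h₁ <;> rcases hf h with h₂ | h₂ | h₂ | h₂ | h₂ <;>
      simp [h₁, h₂, hpq, hqp]
  have h₃ : c ≤ supKer f p h₁ := hc.trans (outer_le_iff.2
    ⟨show f ⊥ ⊔ p = f s ⊔ p by simp [hs], show f t ⊔ p = f ⊤ ⊔ p by simp [ht]⟩)
  have h₄ : c ≤ supKer f q h₂ := hc'.trans (gen_singleton_le_iff.2
    (show f s' ⊔ q = f t' ⊔ q by simp [hs', ht']))
  refine le_iff.2 fun g h hgh => show f g = f h from ?_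
  have hp : f g ⊔ p = f h ⊔ p := le_iff.1 h₃ _ _ hgh
  have hq : f g ⊔ q = f h ⊔ q := le_iff.1 h₄ _ _ hgh
  have key : ∀ k, (f k ⊔ p) ⊓ (f k ⊔ q) = f k := fun k => by
    rcases hf k with h | h | h | h | h <;> simp [h, hpq, sup_comm q p]
  rw [← key g, ← key h, hp, hq]

/-- Dual argument: the collapsed intervals are `[q, ⊤]` and `[r, ⊤]`. -/
theorem le_ker_of_sup_eq_top {f : BoundedLatticeHom F M} {q r : M} (hqr : q ⊔ r = ⊤)
    (hf : ∀ g, f g = ⊤ ∨ f g = q ∨ f g = r ∨ f g = q ⊓ r ∨ f g = ⊥) {s t s' t' : F}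
    (hs : f s = ⊥) (ht : f t = q) (hs' : f s' = r) (ht' : f t' = ⊤) {c : LatticeCon F}
    (hc : c ≤ outer s t) (hc' : c ≤ gen {(s', t')}) : c ≤ ker f := by
  have hrq : r ⊔ q = ⊤ := by rw [sup_comm, hqr]
  have h₁ : ∀ g h, (f g ⊔ f h) ⊓ q = (f g ⊓ q) ⊔ (f h ⊓ q) := fun g h => by
    rcases hf g with h₁ | h₁ | h₁ | h₁ | h₁ <;> rcases hf h with h₂ | h₂ | h₂ | h₂ | h₂ <;>
      simp [h₁, h₂, hqr, hrq, inf_comm r q]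
  have h₂ : ∀ g h, (f g ⊔ f h) ⊓ r = (f g ⊓ r) ⊔ (f h ⊓ r) := fun g h => by
    rcases hf g with h₁ | h₁ | h₁ | h₁ | h₁ <;> rcases hf h with h₂ | h₂ | h₂ | h₂ | h₂ <;>
      simp [h₁, h₂, hqr, hrq]
  have h₃ : c ≤ infKer f q h₁ := hc.trans (outer_le_iff.2
    ⟨show f ⊥ ⊓ q = f s ⊓ q by simp [hs], show f t ⊓ q = f ⊤ ⊓ q by simp [ht]⟩)
  have h₄ : c ≤ infKer f r h₂ := hc'.trans (gen_singleton_le_iff.2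
    (show f s' ⊓ r = f t' ⊓ r by simp [hs', ht']))
  refine le_iff.2 fun g h hgh => show f g = f h from ?_
  have hq : f g ⊓ q = f h ⊓ q := le_iff.1 h₃ _ _ hgh
  have hr : f g ⊓ r = f h ⊓ r := le_iff.1 h₄ _ _ hgh
  have key : ∀ k, (f k ⊓ q) ⊔ (f k ⊓ r) = f k := fun k => by
    rcases hf k with h | h | h | h | h <;> simp [h, hqr, inf_comm r q]
  rw [← key g, ← key h, hq, hr]

/-- On the range, the complement of the filter above `p` is the ideal below `r`. These are the two
classes of a congruence that contains all three joinands and separates `⊥` from `⊤`. -/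
theorem not_le_sup_outer_sup_gen {f : BoundedLatticeHom F M} {p r : M} (hpr : ¬ p ≤ r)
    (hf : ∀ g, p ≤ f g ∨ f g ≤ r) {s t s' t' : F} (hs : f s = p)
    (hs' : f s' = r) (ht' : f t' = ⊤) (ht : f t = ⊤) {c : LatticeCon F} (hc : c ≤ ker f) :
    ¬ gen {(⊥, ⊤)} ≤ c ⊔ outer s' t' ⊔ gen {(s, t)} := by
  have hsup : ∀ g h, p ≤ f (g ⊔ h) ↔ p ≤ f g ∨ p ≤ f h := fun g h => by
    rw [map_sup]
    refine ⟨fun H => ?_, fun H => H.elim le_sup_of_le_left le_sup_of_le_right⟩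
    by_contra! h'
    exact hpr (H.trans (sup_le ((hf g).resolve_left h'.1) ((hf h).resolve_left h'.2)))
  let θ : LatticeCon F :=
    { r := fun g h => p ≤ f g ↔ p ≤ f h
      iseqv := ⟨fun _ => Iff.rfl, Iff.symm, Iff.trans⟩
      inf := fun h h' => by rw [map_inf, map_inf, le_inf_iff, le_inf_iff, h, h']
      sup := fun h h' => by rw [hsup, hsup, h, h'] }
  have hp : ¬ p ≤ (⊥ : M) := fun h => hpr (h.trans bot_le)
  have hθ : c ⊔ outer s' t' ⊔ gen {(s, t)} ≤ θ := by
    refine sup_le (sup_le (hc.trans (le_iff.2 fun g h hgh => ?_)) (outer_le_iff.2 ⟨?_, ?_⟩))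
      (gen_singleton_le_iff.2 ?_)
    · have hgh : f g = f h := hgh
      show p ≤ f g ↔ p ≤ f h
      rw [hgh]
    · show p ≤ f ⊥ ↔ p ≤ f s'
      simp [hs', hpr, hp]
    · show p ≤ f t' ↔ p ≤ f ⊤
      simp [ht']
    · show p ≤ f s ↔ p ≤ f t
      simp [hs, ht]
  intro h
  have : p ≤ f ⊥ ↔ p ≤ f ⊤ := gen_singleton_le_iff.1 (h.trans hθ)
  simp [hp] at this

end LatticeCon

/-! ### Failure of refinement in the free lattice, and the conclusion. -/

open LatticeCon in
/-- In a free bounded lattice of a non-distributive variety, the decompositions of the full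
congruence given by `ℵ_ 2` disjoint pairs of generators have no refinement. -/
theorem IsFreeBoundedLattice.not_exists_refinement {V : LatticeVariety}
    (hV : LatticeVariety.NonDistributive.{t} V) {ι : Type v} {F : Type u} [Lattice F]
    [BoundedOrder F] {x : ι → F} (hF : IsFreeBoundedLattice V x) {J : Type w} (hJ : ℵ_ 2 ≤ #J)
    (e : J × Bool ↪ ι) (s t : J → F) (hs : ∀ l, s l = x (e (l, true)) ⊓ x (e (l, false)))
    (ht : ∀ l, t l = x (e (l, true)) ⊔ x (e (l, false))) :
    ¬ ∃ c : J → J → ConC F, ∀ i j k, (c i j).1 ≤ outer (s i) (t i) ∧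
      (c i j).1 ≤ gen {(s j, t j)} ∧
      gen {(⊥, ⊤)} ≤ (c i j).1 ⊔ outer (s j) (t j) ⊔ gen {(s i, t i)} ∧
      (c i k).1 ≤ (c i j).1 ⊔ (c j k).1 := by
  classical
  rintro ⟨c, hc⟩
  obtain ⟨M, _, _, hM, p, q, r, hpq, hqr, hpr⟩ := hV.exists_bounded
  obtain ⟨H, hH₁, hH₂, hsupp, hrange⟩ := hF.exists_homs e hM
  have hHs : ∀ w l, H w (s l) = (w l).1 ⊓ (w l).2 := fun w l => by rw [hs, map_inf, hH₁, hH₂]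
  have hHt : ∀ w l, H w (t l) = (w l).1 ⊔ (w l).2 := fun w l => by rw [ht, map_sup, hH₁, hH₂]
  -- Whether `H w` collapses `d` is decided by finitely many generating pairs, each of finite
  -- support.
  have support : ∀ d : ConC F, ∃ Y : Set J, Y.Finite ∧
      ∀ w w', Set.EqOn w w' Y → d.1 ≤ ker (H w) → d.1 ≤ ker (H w') := fun d => by
    obtain ⟨T, hT, hTd⟩ := exists_finite_of_isCompactElement d.2
    choose Y hY hYw using hsupp
    refine ⟨⋃ g ∈ T, (Y g.1 ∪ Y g.2), hT.biUnion fun g _ => (hY _).union (hY _),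
      fun w w' h hd => (hTd _).2 fun g hg => ?_⟩
    have hsub : Y g.1 ∪ Y g.2 ⊆ ⋃ g ∈ T, (Y g.1 ∪ Y g.2) :=
      Set.subset_biUnion_of_mem (u := fun g : F × F => Y g.1 ∪ Y g.2) hg
    have h₁ := hYw g.1 w w' (h.mono (Set.subset_union_left.trans hsub))
    have h₂ := hYw g.2 w w' (h.mono (Set.subset_union_right.trans hsub))
    have h₃ : H w g.1 = H w g.2 := (hTd _).1 hd g hg
    show H w' g.1 = H w' g.2
    rw [← h₁, ← h₂, h₃]
  choose Y hY hYw using support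
  obtain ⟨i, j, k, hij, hjk, hik, hk, hi, hj⟩ :=
    Cardinal.exists_free_triple hJ (fun i j => Y (c i j)) fun i j => hY _
  -- The Boolean flags switch on the values at `i`, `j`, `k`; an index that is off gets `(⊥, ⊥)`.
  let val : Bool → Bool → Bool → J → M × M := fun bi bj bk l =>
    if bi ∧ l = i then (p, ⊤) else if bj ∧ l = j then (⊥, q) else
      if bk ∧ l = k then (r, ⊤) else (⊥, ⊥)
  have hrange₂ : ∀ (bi bj bk : Bool) (P : M → Prop), (bi → P p) → (bj → P q) → (bk → P r) →
      P ⊥ → P ⊤ → (∀ g h, P g → P h → P (g ⊓ h)) → (∀ g h, P g → P h → P (g ⊔ h)) →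
      ∀ g, P (H (val bi bj bk) g) := fun bi bj bk P h₁ h₂ h₃ h₄ h₅ h₆ h₇ =>
    hrange _ P (fun l => by
      simp only [val]
      split_ifs with h h' h''
      · exact ⟨h₁ h.1, h₅⟩
      · exact ⟨h₄, h₂ h'.1⟩
      · exact ⟨h₃ h''.1, h₅⟩
      · exact ⟨h₄, h₄⟩) h₄ h₅ h₆ h₇
  have hcij : (c i j).1 ≤ ker (H (val true true false)) := by
    refine le_ker_of_inf_eq_bot (p := p) (q := q) hpq (hrange₂ _ _ _
      (fun m => m = ⊥ ∨ m = p ∨ m = q ∨ m = p ⊔ q ∨ m = ⊤) (by simp) (by simp) (by simp)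
      (by simp) (by simp) ?_ ?_) (s := s i) (t := t i) (s' := s j) (t' := t j) ?_ ?_ ?_ ?_
      (hc i j j).1 (hc i j j).2.1
    · have hqp : q ⊓ p = ⊥ := by rw [inf_comm, hpq]
      rintro g h (h₁ | h₁ | h₁ | h₁ | h₁) (h₂ | h₂ | h₂ | h₂ | h₂) <;>
        simp [h₁, h₂, hpq, hqp]
    · rintro g h (h₁ | h₁ | h₁ | h₁ | h₁) (h₂ | h₂ | h₂ | h₂ | h₂) <;>
        simp [h₁, h₂, sup_comm q p]
    all_goals simp [hHs, hHt, val, hij.symm]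
  have hcjk : (c j k).1 ≤ ker (H (val false true true)) := by
    refine le_ker_of_sup_eq_top (q := q) (r := r) hqr (hrange₂ _ _ _
      (fun m => m = ⊤ ∨ m = q ∨ m = r ∨ m = q ⊓ r ∨ m = ⊥) (by simp) (by simp) (by simp)
      (by simp) (by simp) ?_ ?_) (s := s j) (t := t j) (s' := s k) (t' := t k) ?_ ?_ ?_ ?_
      (hc j k k).1 (hc j k k).2.1
    · rintro g h (h₁ | h₁ | h₁ | h₁ | h₁) (h₂ | h₂ | h₂ | h₂ | h₂) <;>
        simp [h₁, h₂, inf_comm r q]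
    · have hrq : r ⊔ q = ⊤ := by rw [sup_comm, hqr]
      rintro g h (h₁ | h₁ | h₁ | h₁ | h₁) (h₂ | h₂ | h₂ | h₂ | h₂) <;>
        simp [h₁, h₂, hqr, hrq]
    all_goals simp [hHs, hHt, val, hjk.symm]
  -- Switching on `k` does not affect `c i j`, nor `i` affect `c j k`, by freeness of the triple.
  have hcik : (c i k).1 ≤ ker (H (val true true true)) := by
    refine (hc i j k).2.2.2.trans (sup_le (hYw _ _ _ (fun l hl => ?_) hcij)
      (hYw _ _ _ (fun l hl => ?_) hcjk))
    · have : l ≠ k := fun h => hk (h ▸ hl)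
      simp [val, this]
    · have : l ≠ i := fun h => hi (h ▸ hl)
      simp [val, this]
  have hcik' : (c i k).1 ≤ ker (H (val true false true)) := hYw _ _ _ (fun l hl => by
    have : l ≠ j := fun h => hj (h ▸ hl)
    simp [val, this]) hcik
  refine not_le_sup_outer_sup_gen (p := p) (r := r) hpr (hrange₂ _ _ _ (fun m => p ≤ m ∨ m ≤ r)
    (by simp) (by simp) (by simp) (by simp) (by simp) ?_ ?_) (s := s i) (t := t i) (s' := s k)
    (t' := t k) ?_ ?_ ?_ ?_ hcik' (hc i k k).2.2.1
  · rintro g h (hg | hg) (hh | hh)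
    · exact .inl (le_inf hg hh)
    · exact .inr (inf_le_of_right_le hh)
    · exact .inr (inf_le_of_left_le hg)
    · exact .inr (inf_le_of_left_le hg)
  · rintro g h (hg | hg) (hh | hh)
    · exact .inl (le_sup_of_le_left hg)
    · exact .inl (le_sup_of_le_left hg)
    · exact .inl (le_sup_of_le_right hh)
    · exact .inr (sup_le hg hh)
  all_goals simp [hHs, hHt, val, hik.symm]

open LatticeCon in
theorem mainTheorem4 (V : LatticeVariety) (hV : LatticeVariety.NonDistributive.{t} V)
    {ι : Type v} (hι : ℵ_ 2 ≤ #ι)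
    {F : Type u} [Lattice F] [BoundedOrder F] (x : ι → F) (hF : IsFreeBoundedLattice V x) :
    ¬ ∃ (L : Type w) (_ : Lattice L),
      HasAlmostPermutableCongruences L ∧ Nonempty (ConC L ≃o ConC F) := by
  rintro ⟨L, _, hL, ⟨E⟩⟩
  have hreg : (ℵ_ 2 : Cardinal.{v}).IsRegular := by
    have := Cardinal.isRegular_aleph_add_one 1
    rwa [one_add_one_eq_two] at this
  have hinf : ℵ₀ ≤ #ι := (Cardinal.aleph0_le_aleph 2).trans hι
  obtain ⟨e⟩ : Nonempty (ι × Bool ↪ ι) := by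
    rw [← Cardinal.lift_mk_le', Cardinal.mk_prod]
    simpa using (Cardinal.mul_eq_left hinf ((Cardinal.natCast_lt_aleph0 (n := 2)).le.trans hinf)
      two_ne_zero).le
  -- Two generators per index make `s l ≤ t l` automatic while any comparable pair can be prescribed
  -- as its image.
  let s : ι → F := fun l => x (e (l, true)) ⊓ x (e (l, false))
  let t : ι → F := fun l => x (e (l, true)) ⊔ x (e (l, false))
  let a : ι → ConC F := fun l => ⟨outer (s l) (t l), isCompactElement_outer _ _⟩
  let b : ι → ConC F := fun l => ⟨gen {(s l, t l)}, isCompactElement_gen (Set.finite_singleton _)⟩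
  let one : ConC F := ⟨gen {(⊥, ⊤)}, isCompactElement_gen (Set.finite_singleton _)⟩
  have hab : ∀ l, a l ⊔ b l = one := fun l => Subtype.ext (outer_sup_gen _ _)
  obtain ⟨J, hJ, c, hc⟩ := hL.exists_refinement hreg hι (E.symm one) (fun l => E.symm (a l))
    (fun l => E.symm (b l)) fun l => by rw [← map_sup, hab]
  let eJ : J × Bool ↪ ι := (Function.Embedding.prodMap (.subtype _) (.refl _)).trans e
  refine hF.not_exists_refinement hV hJ eJ (fun l => s l) (fun l => t l) (fun _ => rfl)
    (fun _ => rfl) ⟨fun i j => E (c i j), fun i j k => ?_⟩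
  obtain ⟨h₁, h₂, h₃, h₄⟩ := hc i j k
  refine ⟨(E.le_symm_apply.1 h₁ : E (c i j) ≤ a i), (E.le_symm_apply.1 h₂ : E (c i j) ≤ b j),
    ?_, ?_⟩
  · have := E.monotone h₃
    rw [map_sup, map_sup, E.apply_symm_apply, E.apply_symm_apply, E.apply_symm_apply] at this
    exact this
  · have := E.monotone h₄
    rw [map_sup] at this
    exact this
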